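/- **Setting.** Let $N\le M$. There are $N$ agents, double integrators $\dot{\mathbf p}_i=\mathbf v_i$, $\dot{\mathbf v}_i=\mathbf u_i$ in $\mathbb R^2$, and $M$ goals with polynomial trajectories $\mathbf p_k^*(t)=\sum_{l=0}^{\eta_k}\mathbf c_{k,l}t^l$ of degree $\eta_k\ge 2$ (so $\mathbf c_{k,\eta_k}\neq 0$). Let $h>0$. The neighborhood $\mathcal N_i(t)$ of agent $i$ consists of the agents at distance at most $h$ from it, $i$ included. *Energy.* For an agent with state $(\mathbf p_0,\mathbf v_0)$ at time $\tau$, a goal $k$ and a duration $T>0$, let $E_k(T)=\int_0^T\|\mathbf a s+\mathbf b\|^2ds$, where $\mathbf a=\frac{12}{T^3}(\mathbf p_0-\mathbf p_k^*(\tau+T))+\frac{6}{T^2}(\mathbf v_0+\dot{\mathbf p}_k^*(\tau+T))$ and $\mathbf b=-\frac{6}{T^2}(\mathbf p_0-\mathbf p_k^*(\tau+T))-\frac2T(2\mathbf v_0+\dot{\mathbf p}_k^*(\tau+T))$ give the minimum-energy control that brings the agent to the state of the goal at time $\tau+T$; if the agent already has the state of the goal, $T=0$ is allowed as well, with energy $0$.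 Let $E^*_{i,k}(\tau)$ be the infimum of $E_k(T)$ over $T$ for agent $i$; a duration that minimizes $E_k$ is called an optimal arrival time. *Assignment problem.* Each agent $j$ has a set $\mathcal B_j$ of banned goals. The assignment problem of agent $i$ at time $t$ is to minimize $\sum_{j\in\mathcal N_i(t)}\sum_k a_{jk}E^*_{j,k}(t)$ over binary $a_{jk}$ with $\sum_k a_{jk}=1$ for $j\in\mathcal N_i(t)$, $\sum_{j\in\mathcal N_i(t)}a_{jk}\le 1$ for every $k$, and $a_{jk}=0$ for $j\in\mathcal N_i(t)$, $k\in\mathcal B_j$. Agent $i$ prescribes itself the goal $k$ with $a_{ik}=1$ in some optimal solution (and no goal if there is none). *Scheme.* At time $0$ all $\mathcal B_i$ are empty and every agent solves its assignment problem. The competing agents of $i$ are its neighbors $j\ne i$ with the same prescribed goal as $i$. As soon as some agent has a competing agent, an update takes place, and it is repeated as long as there are competing agents. At each update the agents are compared by a priority indicator $\mathbb I_i(j)\in\{0,1\}$, $i\ne j$, that expresses a strict total ordering of the agents ($\mathbb I_i(j)=1$ if $i$ has priority over $j$; it may differ from one update to the next). Every agent $i$ with $\mathbb I_i(j)=0$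 for some competing agent $j$ is permanently banned from its current goal (the goal is added to $\mathcal B_i$), and then solves its assignment problem again. All other agents keep their goals and banned sets; those among them that have competing agents may be assigned to their goal anew. Whenever an agent is assigned (also anew) to a goal for which an optimal arrival time exists, it chooses an optimal arrival time, generates a trajectory of minimum energy $\frac12\int\|\mathbf u\|^2$, possibly under further path constraints, that attains the state of the goal at that time, follows it, and then stays with the goal, all this until it is assigned a goal again. **Theorem 1.** Consider any execution of this scheme. Suppose that $E^*_{i,k}(t_1)\ge E^*_{i,k}(t_2)$ whenever agent $i$ is assigned to goal $k$ at times $t_1<t_2$. Then only finitely many updates take place, the finally prescribed goals of the $N$ agents are pairwise distinct, and there is a finite time from which on every agent has the position and velocity of its finally prescribed goal. -/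

import Mathlib

namespace GoalAssignment

open scoped Classical

noncomputable section

/-- The plane `ℝ²` with its Euclidean norm. -/
abbrev Plane : Type := EuclideanSpace ℝ (Fin 2)

/-- The state of a double integrator: position and velocity. -/
@[ext]
structure State where
  pos : Plane
  vel : Plane

/-! ### Goals -/

/-- `M` goals moving along polynomial trajectories of degree at least two. -/
structure PolyGoals (M : ℕ) where
  deg : Fin M → ℕ
  coeff : Fin M → ℕ → Plane
  two_le_deg : ∀ k, 2 ≤ deg k
  lead_ne_zero : ∀ k, coeff k (deg k) ≠ 0

/-- Position of goal `k` at time `t`: the polynomial `∑ l ≤ deg k, t ^ l • c k l`. -/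
def PolyGoals.pos {M : ℕ} (G : PolyGoals M) (k : Fin M) (t : ℝ) : Plane :=
  ∑ l ∈ Finset.range (G.deg k + 1), t ^ l • G.coeff k l

/-- Velocity of goal `k` at time `t`. -/
def PolyGoals.vel {M : ℕ} (G : PolyGoals M) (k : Fin M) (t : ℝ) : Plane :=
  deriv (G.pos k) t

/-- State (position and velocity) of goal `k` at time `t`. -/
def PolyGoals.state {M : ℕ} (G : PolyGoals M) (k : Fin M) (t : ℝ) : State :=
  ⟨G.pos k t, G.vel k t⟩

/-! ### Minimum energy and optimal arrival time -/

/-- Slope `a` of the minimum-energy control `u s = s • a + b` that steers the state `x₀` to the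
state `x₁` in time `T`. -/
def ctrlSlope (x₀ x₁ : State) (T : ℝ) : Plane :=
  (12 / T ^ 3) • (x₀.pos - x₁.pos) + (6 / T ^ 2) • (x₀.vel + x₁.vel)

/-- Intercept `b` of the minimum-energy control `u s = s • a + b` that steers the state `x₀` to
the state `x₁` in time `T`. -/
def ctrlIntercept (x₀ x₁ : State) (T : ℝ) : Plane :=
  -((6 / T ^ 2) • (x₀.pos - x₁.pos)) - (2 / T) • ((2 : ℝ) • x₀.vel + x₁.vel)

variable {M : ℕ}

/-- Energy `E(T) = ∫₀ᵀ ‖u(s)‖² ds` which an agent that is in state `x` at time `τ` needs in order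
to join goal `k` after the duration `T`, i.e. at time `τ + T`. -/
def energy (G : PolyGoals M) (k : Fin M) (τ : ℝ) (x : State) (T : ℝ) : ℝ :=
  ∫ s in (0 : ℝ)..T,
    ‖s • ctrlSlope x (G.state k (τ + T)) T + ctrlIntercept x (G.state k (τ + T)) T‖ ^ 2

/-- The durations after which the goal can be joined: every positive one, and also `0` for an
agent that is already at the goal and moves with it. -/
def arrivalTimes (G : PolyGoals M) (k : Fin M) (τ : ℝ) (x : State) : Set ℝ :=
  {T | 0 < T ∨ (T = 0 ∧ x = G.state k τ)}

/-- The minimum `E*` of the energy over the arrival time. It is an infimum here; that it is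
attained is not part of the definition. -/
def minEnergy (G : PolyGoals M) (k : Fin M) (τ : ℝ) (x : State) : ℝ :=
  sInf (energy G k τ x '' arrivalTimes G k τ x)

/-- `T` is a minimum-energy arrival time. -/
def IsOptimalArrival (G : PolyGoals M) (k : Fin M) (τ : ℝ) (x : State) (T : ℝ) : Prop :=
  T ∈ arrivalTimes G k τ x ∧ ∀ T' ∈ arrivalTimes G k τ x, energy G k τ x T ≤ energy G k τ x T'

/-! ### Trajectory generation -/

/-- `y` is a trajectory of the double integrator `ṗ = v`, `v̇ = u` on `[τ, τ + T]` from `x₀` to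
`x₁` with a control `u` of finite energy. -/
structure IsTransfer (τ T : ℝ) (x₀ x₁ : State) (y : ℝ → State) (u : ℝ → Plane) : Prop where
  integrable : IntervalIntegrable u MeasureTheory.volume τ (τ + T)
  finite_energy : IntervalIntegrable (fun s => ‖u s‖ ^ 2) MeasureTheory.volume τ (τ + T)
  vel_eq : ∀ t ∈ Set.Icc τ (τ + T), (y t).vel = x₀.vel + ∫ s in τ..t, u s
  pos_eq : ∀ t ∈ Set.Icc τ (τ + T), (y t).pos = x₀.pos + ∫ s in τ..t, (y s).vel
  final : y (τ + T) = x₁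

/-- `y` with control `u` minimizes the energy `½ ∫ ‖u‖²` among all trajectories from `x₀` to `x₁`
on `[τ, τ + T]` that satisfy the path constraints `K` (for instance bounds on speed and control,
or separation from other agents; `K = Set.univ` if there are none). -/
def IsOptimalTransfer (K : Set ((ℝ → State) × (ℝ → Plane))) (τ T : ℝ) (x₀ x₁ : State)
    (y : ℝ → State) (u : ℝ → Plane) : Prop :=
  IsTransfer τ T x₀ x₁ y u ∧ (y, u) ∈ K ∧
    ∀ y' u', IsTransfer τ T x₀ x₁ y' u' → (y', u') ∈ K →
      (1 / 2) * ∫ s in τ..(τ + T), ‖u s‖ ^ 2 ≤ (1 / 2) * ∫ s in τ..(τ + T), ‖u' s‖ ^ 2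

/-! ### Neighborhoods and the local assignment problem -/

variable {N : ℕ}

/-- The neighborhood of agent `i`: all agents within the sensing horizon `h`, `i` included. -/
def nbhd (h : ℝ) (x : Fin N → State) (i : Fin N) : Finset (Fin N) :=
  Finset.univ.filter fun j => dist (x i).pos (x j).pos ≤ h

/-- Feasibility in the assignment problem for the agents in `S` with banned goals `B`: a binary
matrix that assigns each agent of `S` to exactly one goal, each goal to at most one agent of `S`,
and no agent of `S` to one of its banned goals. Rows outside `S` play no role. -/
structure IsFeasible (S : Finset (Fin N)) (B : Fin N → Finset (Fin M))
    (a : Matrix (Fin N) (Fin M) ℕ) : Prop where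
  binary : ∀ j k, a j k = 0 ∨ a j k = 1
  row : ∀ j ∈ S, ∑ k, a j k = 1
  col : ∀ k, ∑ j ∈ S, a j k ≤ 1
  banned : ∀ j ∈ S, ∀ k ∈ B j, a j k = 0

/-- Total energy of an assignment of the agents in `S`, for energies `E j k`. -/
def cost (S : Finset (Fin N)) (E : Fin N → Fin M → ℝ) (a : Matrix (Fin N) (Fin M) ℕ) : ℝ :=
  ∑ j ∈ S, ∑ k, (a j k : ℝ) * E j k

/-- Optimal solutions of the assignment problem. -/
def IsOptimalAssignment (S : Finset (Fin N)) (B : Fin N → Finset (Fin M))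
    (E : Fin N → Fin M → ℝ) (a : Matrix (Fin N) (Fin M) ℕ) : Prop :=
  IsFeasible S B a ∧ ∀ a', IsFeasible S B a' → cost S E a ≤ cost S E a'

/-- `γ` is a goal which agent `i` may prescribe to itself at time `τ`, when the states are `x` and
the banned sets are `B`: the goal that some optimal solution of its assignment problem over its
neighborhood gives to `i`, or no goal at all if that problem has no solution. -/
def Prescribes (G : PolyGoals M) (h τ : ℝ) (x : Fin N → State) (B : Fin N → Finset (Fin M))
    (i : Fin N) (γ : Option (Fin M)) : Prop :=
  (∃ a k, IsOptimalAssignment (nbhd h x i) B (fun j l => minEnergy G l τ (x j)) a ∧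
      a i k = 1 ∧ γ = some k) ∨
  ((¬ ∃ a, IsOptimalAssignment (nbhd h x i) B (fun j l => minEnergy G l τ (x j)) a) ∧ γ = none)

/-! ### Competition and priority -/

/-- The agents competing with `i`: the other neighbors that have prescribed themselves the same
goal. -/
def competing (h : ℝ) (x : Fin N → State) (g : Fin N → Option (Fin M)) (i : Fin N) :
    Finset (Fin N) :=
  (nbhd h x i).filter fun j => j ≠ i ∧ ∃ k, g i = some k ∧ g j = some k

/-- A priority indicator: `I i j = true` says that `i` has priority over `j`. Exactly one of two
distinct agents has priority over the other, and priority is an ordering of the agents. -/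
structure IsPriority (I : Fin N → Fin N → Bool) : Prop where
  asymm : ∀ i j, i ≠ j → (I i j = true ↔ I j i = false)
  trans : ∀ i j k, i ≠ j → j ≠ k → i ≠ k → I i j = true → I j k = true → I i k = true

/-- Agent `i` competes with some agent over which it has no priority. -/
def Loses (h : ℝ) (x : Fin N → State) (g : Fin N → Option (Fin M)) (I : Fin N → Fin N → Bool)
    (i : Fin N) : Prop :=
  ∃ j ∈ competing h x g i, I i j = false

/-! ### Executions of the banning and reassignment scheme -/

/-- The data of an execution. Updates are numbered by `n = 0, 1, 2, …`, the initial assignment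
being update `0`; the goals `goal n` and banned sets `ban n` are those after update `n`, in force
until update `n + 1`. There need not be infinitely many updates: the entries for an `n` for which
`occurs n` fails have no meaning. -/
structure Run (N M : ℕ) where
  /-- the states of the agents as functions of time -/
  state : Fin N → ℝ → State
  /-- update `n` takes place -/
  occurs : ℕ → Prop
  /-- the time of update `n` -/
  time : ℕ → ℝ
  /-- the prescribed goals -/
  goal : ℕ → Fin N → Option (Fin M)
  /-- the banned goals -/
  ban : ℕ → Fin N → Finset (Fin M)
  /-- the agents which are assigned a goal and plan a trajectory to it at update `n` -/
  assigned : ℕ → Finset (Fin N)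
  /-- the priority indicator used at update `n` -/
  prio : ℕ → Fin N → Fin N → Bool
  /-- the path constraints that agent `i` takes into account when planning at update `n` -/
  constraints : ℕ → Fin N → Set ((ℝ → State) × (ℝ → Plane))

namespace Run

/-- Agent `i` is assigned to goal `k` at update `n`. -/
def AssignedTo (r : Run N M) (n : ℕ) (i : Fin N) (k : Fin M) : Prop :=
  r.occurs n ∧ i ∈ r.assigned n ∧ r.goal n i = some k

/-- The trajectory which agent `i` planned at update `n` is in force at time `t`: no later update
has replaced it before `t`. -/
def InForce (r : Run N M) (n : ℕ) (i : Fin N) (t : ℝ) : Prop :=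
  r.time n ≤ t ∧ ∀ m, n < m → r.occurs m → i ∈ r.assigned m → t ≤ r.time m

/-- The times, from update `n` on, at which some agent has a competitor under the goals
prescribed at update `n`. -/
def conflictTimes (r : Run N M) (h : ℝ) (n : ℕ) : Set ℝ :=
  {t | r.time n ≤ t ∧ ∃ i, (competing h (fun j => r.state j t) (r.goal n) i).Nonempty}

/-- Agent `i` loses a competition at the time of update `n + 1`. -/
def LosesAt (r : Run N M) (h : ℝ) (n : ℕ) (i : Fin N) : Prop :=
  Loses h (fun j => r.state j (r.time (n + 1))) (r.goal n) (r.prio (n + 1)) i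

/-- `r` is an execution of the banning and reassignment scheme. -/
structure IsExecution (r : Run N M) (G : PolyGoals M) (h : ℝ) : Prop where
  /-- Initially, at time `0`, nothing is banned and every agent prescribes itself a goal. -/
  occurs_zero : r.occurs 0
  time_zero : r.time 0 = 0
  ban_zero : ∀ i, r.ban 0 i = ∅
  assigned_zero : r.assigned 0 = Finset.univ
  goal_zero : ∀ i, Prescribes G h 0 (fun j => r.state j 0) (r.ban 0) i (r.goal 0 i)
  /-- The next update takes place as soon as some agent has a competitor, and only then. -/
  occurs_succ : ∀ n, r.occurs (n + 1) ↔ r.occurs n ∧ (r.conflictTimes h n).Nonempty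
  time_succ : ∀ n, r.occurs (n + 1) → IsLeast (r.conflictTimes h n) (r.time (n + 1))
  /-- At every update the agents are compared through a priority indicator. -/
  priority : ∀ n, r.occurs (n + 1) → IsPriority (r.prio (n + 1))
  /-- An agent that loses a competition is banned from its current goal, and solves its
  assignment problem again with the new banned sets. -/
  loser_ban : ∀ n i, r.occurs (n + 1) → r.LosesAt h n i →
    r.ban (n + 1) i = r.ban n i ∪ (r.goal n i).toFinset
  loser_goal : ∀ n i, r.occurs (n + 1) → r.LosesAt h n i →
    Prescribes G h (r.time (n + 1)) (fun j => r.state j (r.time (n + 1))) (r.ban (n + 1)) i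
      (r.goal (n + 1) i)
  loser_assigned : ∀ n i, r.occurs (n + 1) → r.LosesAt h n i → i ∈ r.assigned (n + 1)
  /-- All other agents keep their goals and banned sets; those among them which have competitors
  may be assigned to their goal anew, planning a new trajectory to it. -/
  keep_ban : ∀ n i, r.occurs (n + 1) → ¬ r.LosesAt h n i → r.ban (n + 1) i = r.ban n i
  keep_goal : ∀ n i, r.occurs (n + 1) → ¬ r.LosesAt h n i → r.goal (n + 1) i = r.goal n i
  assigned_subset : ∀ n i, r.occurs (n + 1) → i ∈ r.assigned (n + 1) →
    (competing h (fun j => r.state j (r.time (n + 1))) (r.goal n) i).Nonempty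
  /-- An agent that is assigned to a goal determines a minimum-energy arrival time, if there is
  one, generates an energy-optimal trajectory that joins the goal at that time, follows it, and
  then stays with the goal, all this until it is assigned a goal again. -/
  motion : ∀ n i k, r.AssignedTo n i k →
    (∃ T, IsOptimalArrival G k (r.time n) (r.state i (r.time n)) T) →
    ∃ T, IsOptimalArrival G k (r.time n) (r.state i (r.time n)) T ∧
      (∃ y u, IsOptimalTransfer (r.constraints n i) (r.time n) T (r.state i (r.time n))
          (G.state k (r.time n + T)) y u ∧
        ∀ t, r.InForce n i t → t ≤ r.time n + T → r.state i t = y t) ∧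
      ∀ t, r.InForce n i t → r.time n + T ≤ t → r.state i t = G.state k t

/-- The minimum energy of each agent for a goal does not increase from one assignment of the agent
to this goal to a later one. -/
def EnergyNonincreasing (r : Run N M) (G : PolyGoals M) : Prop :=
  ∀ i k m n, r.AssignedTo m i k → r.AssignedTo n i k → r.time m < r.time n →
    minEnergy G k (r.time n) (r.state i (r.time n)) ≤
      minEnergy G k (r.time m) (r.state i (r.time m))

end Run

end

end GoalAssignment

/-! Every update permanently bans some agent from a goal that was still allowed to it, so the total
number of bans grows strictly while staying at most `N * M`; hence there are finitely many updates
(`le_sum_card_ban`, `exists_last_update`). This needs the assignment problems to stay solvable. The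
top-priority holder of a goal never loses it, so every banned goal keeps a holder not banned from it
(`exists_holder`). Goals banned for a whole set `A` of agents thus have distinct holders outside
`A`, at most `N - |A|` of them, and Hall's condition follows from `N ≤ M`
(`exists_injective_notMem_ban`). After the last update each agent follows its last plan. Its arrival
time exists because the energy blows up both as `T → 0`, unless the agent is already at the goal,
and as `T → ∞` (`exists_isOptimalArrival`). Two agents with the same final goal would eventually
coincide, hence compete, and force another update. -/

namespace GoalAssignment

open scoped Classical
open Filter Topology

/-! ### Regularity of the goal trajectories -/

/-- The `j`-th coordinate of the trajectory of goal `k`, as a polynomial. -/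
noncomputable def PolyGoals.coordPoly {M : ℕ} (G : PolyGoals M) (k : Fin M) (j : Fin 2) :
    Polynomial ℝ :=
  ∑ l ∈ Finset.range (G.deg k + 1), Polynomial.monomial l (G.coeff k l j)

theorem PolyGoals.pos_apply {M : ℕ} (G : PolyGoals M) (k : Fin M) (j : Fin 2) (t : ℝ) :
    G.pos k t j = (G.coordPoly k j).eval t := by
  simp [PolyGoals.pos, PolyGoals.coordPoly, Polynomial.eval_finsetSum, mul_comm]

theorem PolyGoals.contDiff_pos {M : ℕ} (G : PolyGoals M) (k : Fin M) :
    ContDiff ℝ 1 (G.pos k) := by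
  unfold PolyGoals.pos
  fun_prop

theorem PolyGoals.continuous_pos {M : ℕ} (G : PolyGoals M) (k : Fin M) :
    Continuous (G.pos k) :=
  (G.contDiff_pos k).continuous

theorem PolyGoals.continuous_vel {M : ℕ} (G : PolyGoals M) (k : Fin M) :
    Continuous (G.vel k) :=
  (G.contDiff_pos k).continuous_deriv le_rfl

theorem PolyGoals.vel_apply {M : ℕ} (G : PolyGoals M) (k : Fin M) (j : Fin 2) (t : ℝ) :
    G.vel k t j = (G.coordPoly k j).derivative.eval t := by
  have h1 : HasDerivAt (G.pos k) (G.vel k t) t :=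
    ((G.contDiff_pos k).differentiable one_ne_zero t).hasDerivAt
  have h2 : HasDerivAt (fun s => G.pos k s j) (G.vel k t j) t :=
    (EuclideanSpace.proj j : Plane →L[ℝ] ℝ).hasFDerivAt.comp_hasDerivAt t h1
  simp only [G.pos_apply k j] at h2
  exact h2.unique ((G.coordPoly k j).hasDerivAt t)

theorem PolyGoals.coeff_coordPoly_deg {M : ℕ} (G : PolyGoals M) (k : Fin M) (j : Fin 2) :
    (G.coordPoly k j).coeff (G.deg k) = G.coeff k (G.deg k) j := by
  simp [PolyGoals.coordPoly, Polynomial.coeff_monomial]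

/-- Some coordinate of the velocity of a goal is a nonconstant polynomial. -/
theorem PolyGoals.exists_one_le_degree_derivative {M : ℕ} (G : PolyGoals M) (k : Fin M) :
    ∃ j, 1 ≤ (G.coordPoly k j).derivative.natDegree := by
  obtain ⟨j, hj⟩ : ∃ j, G.coeff k (G.deg k) j ≠ 0 := by
    by_contra! H
    exact G.lead_ne_zero k (by ext j; simpa using H j)
  refine ⟨j, ?_⟩
  rw [← G.coeff_coordPoly_deg k j] at hj
  have h2 := G.two_le_deg k
  have h1 : G.deg k ≤ (G.coordPoly k j).natDegree := Polynomial.le_natDegree_of_ne_zero hj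
  have h3 := Polynomial.natDegree_derivative (G.coordPoly k j)
  omega

/-! ### Existence of optimal arrival times -/

section Energy

variable {M : ℕ} (G : PolyGoals M) (k : Fin M) (τ : ℝ) (x : State)

theorem integral_norm_affine_sq (a b : Plane) (T : ℝ) :
    ∫ s in (0 : ℝ)..T, ‖s • a + b‖ ^ 2 =
      T ^ 3 / 3 * ‖a‖ ^ 2 + T ^ 2 * inner ℝ a b + T * ‖b‖ ^ 2 := by
  have hd : ∀ s ∈ Set.uIcc 0 T, HasDerivAt
      (fun s : ℝ => s ^ 3 / 3 * ‖a‖ ^ 2 + s ^ 2 * inner ℝ a b + s * ‖b‖ ^ 2)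
      (‖s • a + b‖ ^ 2) s := by
    intro s _
    have h := ((((hasDerivAt_pow 3 s).div_const 3).mul_const (‖a‖ ^ 2)).add
      ((hasDerivAt_pow 2 s).mul_const (inner ℝ a b))).add ((hasDerivAt_id s).mul_const (‖b‖ ^ 2))
    refine h.congr_deriv ?_
    rw [norm_add_sq_real, norm_smul, mul_pow, real_inner_smul_left, Real.norm_eq_abs, sq_abs]
    norm_num
    ring
  rw [intervalIntegral.integral_eq_sub_of_hasDerivAt hd
    (Continuous.intervalIntegrable (by fun_prop) _ _)]
  ring

/-- The affine control splits orthogonally into its deviation from the mean (first term) and its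
mean, the velocity change over `T` (second term). Both terms are nonnegative, so either one alone
bounds the energy from below. -/
theorem energy_eq {T : ℝ} (hT : 0 < T) :
    energy G k τ x T =
      (3 * ‖(2 : ℝ) • (x.pos - G.pos k (τ + T)) + T • (x.vel + G.vel k (τ + T))‖ ^ 2) / T ^ 3 +
        ‖x.vel - G.vel k (τ + T)‖ ^ 2 / T := by
  unfold energy
  rw [integral_norm_affine_sq]
  simp only [ctrlSlope, ctrlIntercept, PolyGoals.state, EuclideanSpace.real_norm_sq_eq,
    PiLp.inner_apply, Fin.sum_univ_two, PiLp.add_apply, PiLp.sub_apply, PiLp.neg_apply,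
    PiLp.smul_apply, smul_eq_mul, RCLike.inner_apply, conj_trivial]
  field_simp
  ring

theorem continuousOn_energy : ContinuousOn (energy G k τ x) (Set.Ioi 0) := by
  have hp := G.continuous_pos k
  have hv := G.continuous_vel k
  refine ContinuousOn.congr ?_ fun T hT => energy_eq G k τ x hT
  refine ContinuousOn.add (ContinuousOn.div (Continuous.continuousOn (by fun_prop))
    (by fun_prop) fun T hT => ?_) (ContinuousOn.div (Continuous.continuousOn (by fun_prop))
    (by fun_prop) fun T hT => ?_)
  · exact pow_ne_zero 3 (ne_of_gt hT)
  · exact ne_of_gt hT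

/-- The mean-control term suffices: degree at least two makes a velocity coordinate a nonconstant
polynomial, whose square outgrows `T`. -/
theorem tendsto_energy_atTop : Tendsto (energy G k τ x) atTop atTop := by
  obtain ⟨j, hj⟩ := G.exists_one_le_degree_derivative k
  set P := (G.coordPoly k j).derivative - Polynomial.C (x.vel j) with hP
  have hPd : 1 ≤ P.natDegree := by rwa [hP, Polynomial.natDegree_sub_C]
  have hP0 : P ≠ 0 := by
    rintro h
    simp [h] at hPd
  -- In the absolute time `s = τ + T` the denominator `s - τ` is the duration `T`.
  have key : Tendsto (fun s => (P ^ 2).eval s / (Polynomial.X - Polynomial.C τ).eval s)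
      atTop atTop := by
    refine Polynomial.div_tendsto_atTop_of_degree_gt _ _ ?_ (Polynomial.X_sub_C_ne_zero τ) ?_
    · rw [Polynomial.degree_X_sub_C, Polynomial.degree_eq_natDegree (pow_ne_zero 2 hP0),
        Polynomial.natDegree_pow]
      exact_mod_cast (by omega : 1 < 2 * P.natDegree)
    · rw [Polynomial.leadingCoeff_pow, Polynomial.leadingCoeff_X_sub_C, div_one]
      positivity
  refine tendsto_atTop_mono' _ ?_ (key.comp (tendsto_atTop_add_const_left _ τ tendsto_id))
  filter_upwards [eventually_gt_atTop 0] with T hT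
  rw [energy_eq G k τ x hT]
  have h1 : (P.eval (τ + T)) ^ 2 ≤ ‖x.vel - G.vel k (τ + T)‖ ^ 2 := by
    have h2 : P.eval (τ + T) = -((x.vel - G.vel k (τ + T)) j) := by
      simp [hP, G.vel_apply]
    have h3 := PiLp.norm_apply_le (x.vel - G.vel k (τ + T)) j
    rw [h2, neg_sq, ← sq_abs, ← Real.norm_eq_abs]
    gcongr
  have h4 : (P.eval (τ + T)) ^ 2 / T ≤ ‖x.vel - G.vel k (τ + T)‖ ^ 2 / T := by gcongr
  have h5 : 0 ≤ (3 * ‖(2 : ℝ) • (x.pos - G.pos k (τ + T)) +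
    T • (x.vel + G.vel k (τ + T))‖ ^ 2) / T ^ 3 := by positivity
  simpa using h4.trans (le_add_of_nonneg_left h5)

/-- A velocity mismatch costs order `1 / T`; if the velocities agree, the position mismatch costs
order `1 / T ^ 3`. -/
theorem tendsto_energy_nhdsGT_zero (hx : x ≠ G.state k τ) :
    Tendsto (energy G k τ x) (𝓝[>] 0) atTop := by
  have hp := G.continuous_pos k
  have hv := G.continuous_vel k
  have hinv : Tendsto (fun T : ℝ => T⁻¹) (𝓝[>] 0) atTop := tendsto_inv_nhdsGT_zero
  by_cases hvel : x.vel = G.vel k τ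
  · have hpos : x.pos - G.pos k τ ≠ 0 := fun H => hx (State.ext (sub_eq_zero.1 H) hvel)
    set f : ℝ → ℝ := fun T =>
      3 * ‖(2 : ℝ) • (x.pos - G.pos k (τ + T)) + T • (x.vel + G.vel k (τ + T))‖ ^ 2 with hf
    have hc : Continuous f := by fun_prop
    have hf0 : 0 < f 0 := by
      have : 0 < ‖x.pos - G.pos k τ‖ := norm_pos_iff.2 hpos
      simp only [hf, add_zero, zero_smul, norm_smul, Real.norm_ofNat]
      positivity
    have h3 : Tendsto (fun T : ℝ => (T⁻¹) ^ 3) (𝓝[>] 0) atTop :=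
      (tendsto_pow_atTop three_ne_zero).comp hinv
    refine tendsto_atTop_mono' _ ?_
      ((hc.tendsto 0).mono_left nhdsWithin_le_nhds |>.pos_mul_atTop hf0 h3)
    filter_upwards [self_mem_nhdsWithin] with T hT
    have hT : 0 < T := hT
    rw [energy_eq G k τ x hT, inv_pow, ← div_eq_mul_inv]
    exact le_add_of_nonneg_right (by positivity)
  · set f : ℝ → ℝ := fun T => ‖x.vel - G.vel k (τ + T)‖ ^ 2 with hf
    have hc : Continuous f := by fun_prop
    have hf0 : 0 < f 0 := by
      have : 0 < ‖x.vel - G.vel k τ‖ := norm_pos_iff.2 (sub_ne_zero.2 hvel)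
      simp only [hf, add_zero]
      positivity
    refine tendsto_atTop_mono' _ ?_
      ((hc.tendsto 0).mono_left nhdsWithin_le_nhds |>.pos_mul_atTop hf0 hinv)
    filter_upwards [self_mem_nhdsWithin] with T hT
    have hT : 0 < T := hT
    rw [energy_eq G k τ x hT, ← div_eq_mul_inv]
    exact le_add_of_nonneg_left (by positivity)

/-- A function on the positive reals that is continuous and coercive attains its minimum. -/
theorem exists_forall_le_of_tendsto_atTop {f : ℝ → ℝ} (hc : ContinuousOn f (Set.Ioi 0))
    (h0 : Tendsto f (𝓝[>] 0) atTop) (h1 : Tendsto f atTop atTop) :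
    ∃ T, 0 < T ∧ ∀ T', 0 < T' → f T ≤ f T' := by
  -- The value `f 1` is the threshold: `f` exceeds it outside `[ε, R]`, so `1` lies in that interval
  -- and the minimum there is global.
  obtain ⟨ε, hε, hfε⟩ := mem_nhdsGT_iff_exists_Ioo_subset.1
    (h0.eventually (eventually_gt_atTop (f 1)))
  obtain ⟨R, hR⟩ := eventually_atTop.1 (h1.eventually (eventually_gt_atTop (f 1)))
  have hε : 0 < ε := hε
  have hlow : ∀ T, 0 < T → T < ε → f 1 < f T := fun T a b => hfε ⟨a, b⟩
  have hε1 : ε ≤ 1 := by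
    by_contra! H
    exact lt_irrefl _ (hlow 1 one_pos H)
  have hR1 : 1 < R := by
    by_contra! H
    exact lt_irrefl _ (hR 1 H)
  obtain ⟨T, hT, hmin⟩ := (isCompact_Icc (a := ε) (b := R)).exists_isMinOn
    ⟨1, hε1, hR1.le⟩ (hc.mono fun s hs => hε.trans_le hs.1)
  have hT1 : f T ≤ f 1 := hmin ⟨hε1, hR1.le⟩
  refine ⟨T, hε.trans_le hT.1, fun T' hT' => ?_⟩
  rcases lt_or_ge T' ε with h | h
  · exact hT1.trans (hlow T' hT' h).le
  · rcases le_or_gt T' R with h' | h'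
    · exact hmin ⟨h, h'⟩
    · exact hT1.trans (hR T' h'.le).le

/-- At the goal, `T = 0` has an empty integral and hence the least possible energy; elsewhere only
positive durations are admissible and coercivity applies. -/
theorem exists_isOptimalArrival : ∃ T, IsOptimalArrival G k τ x T := by
  by_cases hx : x = G.state k τ
  · refine ⟨0, Or.inr ⟨rfl, hx⟩, fun T' hT' => ?_⟩
    have hT0 : 0 ≤ T' := hT'.elim le_of_lt fun h => h.1.ge
    have h0 : energy G k τ x 0 = 0 := by simp [energy]
    rw [h0]
    exact intervalIntegral.integral_nonneg hT0 fun s _ => by positivity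
  · obtain ⟨T, hT, hmin⟩ := exists_forall_le_of_tendsto_atTop (continuousOn_energy G k τ x)
      (tendsto_energy_nhdsGT_zero G k τ x hx) (tendsto_energy_atTop G k τ x)
    exact ⟨T, Or.inl hT, fun T' hT' => hmin T' (hT'.resolve_right fun h => hx h.2)⟩

end Energy

/-! ### Solvability of the assignment problems -/

section Assignment

variable {N M : ℕ}

/-- If every banned goal is held by an agent that is not banned from it, the agents can be
assigned to distinct goals that are not banned. -/
theorem exists_injective_notMem_ban (hNM : N ≤ M) (B : Fin N → Finset (Fin M))
    (g : Fin N → Option (Fin M)) (hB : ∀ j, ∀ k ∈ B j, ∃ i, g i = some k ∧ k ∉ B i) :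
    ∃ f : Fin N → Fin M, Function.Injective f ∧ ∀ j, f j ∉ B j := by
  have hall : ∀ A : Finset (Fin N), A.card ≤ (A.biUnion fun j => (B j)ᶜ).card := by
    intro A
    rcases A.eq_empty_or_nonempty with rfl | ⟨j₀, hj₀⟩
    · simp
    -- A goal unavailable to all of `A` has an unbanned holder, necessarily outside `A`; a holder
    -- determines its goal, so choosing holders is injective.
    have hC : ∀ k ∈ (A.biUnion fun j => (B j)ᶜ)ᶜ, ∃ i ∈ Aᶜ, g i = some k := by
      intro k hk
      have hk' : ∀ j ∈ A, k ∈ B j := by simpa using hk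
      obtain ⟨i, hi, hki⟩ := hB j₀ k (hk' j₀ hj₀)
      exact ⟨i, Finset.mem_compl.2 fun hA => hki (hk' i hA), hi⟩
    have : Nonempty (Fin N) := ⟨j₀⟩
    choose! w hw hgw using hC
    have hle : (A.biUnion fun j => (B j)ᶜ)ᶜ.card ≤ Aᶜ.card :=
      Finset.card_le_card_of_injOn w hw fun k hk l hl hkl => by
        have h1 := hgw k hk
        rw [hkl, hgw l hl] at h1
        exact (Option.some_injective _ h1).symm
    have h1 := Finset.card_add_card_compl A
    have h2 := Finset.card_add_card_compl (A.biUnion fun j => (B j)ᶜ)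
    simp only [Fintype.card_fin] at h1 h2
    omega
  obtain ⟨f, hf, hfB⟩ := (Finset.all_card_le_biUnion_card_iff_exists_injective _).1 hall
  exact ⟨f, hf, fun j => by simpa using hfB j⟩

theorem isFeasible_of_injective (S : Finset (Fin N)) (B : Fin N → Finset (Fin M))
    {f : Fin N → Fin M} (hf : Function.Injective f) (hfB : ∀ j, f j ∉ B j) :
    IsFeasible S B (fun j k => if f j = k then 1 else 0) where
  binary j k := by by_cases h : f j = k <;> simp [h]
  row j _ := by simp
  col k := by
    rw [← Finset.card_filter, Finset.card_le_one]
    intro a ha b hb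
    exact hf ((Finset.mem_filter.1 ha).2.trans (Finset.mem_filter.1 hb).2.symm)
  banned j _ k hk := if_neg fun h : f j = k => hfB j (h ▸ hk)

theorem exists_isOptimalAssignment (S : Finset (Fin N)) (B : Fin N → Finset (Fin M))
    (E : Fin N → Fin M → ℝ) (hne : ∃ a, IsFeasible S B a) :
    ∃ a, IsOptimalAssignment S B E a := by
  -- `binary` also restricts the rows outside `S`, which makes the feasible set finite.
  have hfin : {a : Matrix (Fin N) (Fin M) ℕ | IsFeasible S B a}.Finite := by
    refine (Set.Finite.pi' (t := fun _ : Fin N => {v : Fin M → ℕ | ∀ k, v k ∈ ({0, 1} : Set ℕ)})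
      fun _ => Set.Finite.pi' fun _ => Set.toFinite _).subset fun a ha j k => ?_
    simpa using ha.binary j k
  obtain ⟨a, ha, hmin⟩ := Set.exists_min_image _ (cost S E) hfin hne
  exact ⟨a, ha, hmin⟩

theorem mem_nbhd_self {h : ℝ} (hh : 0 < h) (x : Fin N → State) (i : Fin N) :
    i ∈ nbhd h x i := by
  simp [nbhd, hh.le]

/-- A matching of all agents is feasible for every neighborhood, so the case of no goal cannot
arise; the ban applies to `i` because `i` is its own neighbor. -/
theorem Prescribes.exists_eq_some {G : PolyGoals M} {h τ : ℝ} {x : Fin N → State}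
    {B : Fin N → Finset (Fin M)} {i : Fin N} {γ : Option (Fin M)} (hγ : Prescribes G h τ x B i γ)
    (hh : 0 < h) (hB : ∃ f : Fin N → Fin M, Function.Injective f ∧ ∀ j, f j ∉ B j) :
    ∃ k, γ = some k ∧ k ∉ B i := by
  rcases hγ with ⟨a, k, ha, hak, rfl⟩ | ⟨hno, _⟩
  · refine ⟨k, rfl, fun hk => ?_⟩
    have := ha.1.banned i (mem_nbhd_self hh x i) k hk
    omega
  · obtain ⟨f, hf, hfB⟩ := hB
    exact absurd (exists_isOptimalAssignment _ B _ ⟨_, isFeasible_of_injective _ B hf hfB⟩) hno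

theorem mem_competing {h : ℝ} {x : Fin N → State} {g : Fin N → Option (Fin M)} {i j : Fin N} :
    j ∈ competing h x g i ↔
      dist (x i).pos (x j).pos ≤ h ∧ j ≠ i ∧ ∃ k, g i = some k ∧ g j = some k := by
  simp [competing, nbhd]

theorem mem_competing_comm {h : ℝ} {x : Fin N → State} {g : Fin N → Option (Fin M)}
    {i j : Fin N} (hj : j ∈ competing h x g i) : i ∈ competing h x g j := by
  obtain ⟨hd, hne, k, hi, hj⟩ := mem_competing.1 hj
  exact mem_competing.2 ⟨dist_comm (x i).pos _ ▸ hd, hne.symm, k, hj, hi⟩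

theorem IsPriority.exists_max {I : Fin N → Fin N → Bool} (hI : IsPriority I) {s : Set (Fin N)}
    (hs : s.Nonempty) : ∃ m ∈ s, ∀ j ∈ s, j ≠ m → I m j = true := by
  -- The diagonal of `I` is arbitrary and must be removed to get a strict order; its minimal
  -- elements have top priority.
  let R : Fin N → Fin N → Prop := fun i j => i ≠ j ∧ I i j = true
  have hirr : Std.Irrefl R := ⟨fun i h => h.1 rfl⟩
  have htr : IsTrans (Fin N) R := ⟨fun i j k hij hjk => by
    have hik : i ≠ k := by
      rintro rfl
      have := (hI.asymm i j hij.1).1 hij.2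
      simp [hjk.2] at this
    exact ⟨hik, hI.trans i j k hij.1 hjk.1 hik hij.2 hjk.2⟩⟩
  obtain ⟨m, hm, hmin⟩ := (Finite.wellFounded_of_trans_of_irrefl R).has_min s hs
  refine ⟨m, hm, fun j hj hjm => (hI.asymm m j hjm.symm).2 ?_⟩
  by_contra H
  exact hmin j hj ⟨hjm, by simpa using H⟩

/-- Among the agents with a given goal, one does not lose. -/
theorem exists_not_loses {I : Fin N → Fin N → Bool} (hI : IsPriority I) (h : ℝ)
    (x : Fin N → State) (g : Fin N → Option (Fin M)) {i : Fin N} {k : Fin M}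
    (hi : g i = some k) : ∃ j, g j = some k ∧ ¬ Loses h x g I j := by
  -- The maximum is over all holders of `k`, near or far, so it beats every competitor.
  obtain ⟨m, hm, hmax⟩ := hI.exists_max (s := {j | g j = some k}) ⟨i, hi⟩
  refine ⟨m, hm, ?_⟩
  rintro ⟨j, hj, hlt⟩
  obtain ⟨_, hne, l, hml, hjl⟩ := mem_competing.1 hj
  have hm' : g m = some k := hm
  have hjk : g j = some k := by rw [hjl, ← hml, hm']
  simp [hmax j hjk hne] at hlt

theorem exists_loses {I : Fin N → Fin N → Bool} (hI : IsPriority I) {h : ℝ}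
    {x : Fin N → State} {g : Fin N → Option (Fin M)} {i : Fin N}
    (hi : (competing h x g i).Nonempty) : ∃ j, Loses h x g I j := by
  obtain ⟨j, hj⟩ := hi
  have hne : i ≠ j := (mem_competing.1 hj).2.1.symm
  rcases hij : I i j with _ | _
  · exact ⟨i, j, hj, hij⟩
  · exact ⟨j, i, mem_competing_comm hj, (hI.asymm i j hne).1 hij⟩

end Assignment

/-! ### Executions -/

namespace Run.IsExecution

variable {N M : ℕ} {r : Run N M} {G : PolyGoals M} {h : ℝ}

theorem occurs_of_le (hr : r.IsExecution G h) {m n : ℕ} (hmn : m ≤ n) (hn : r.occurs n) :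
    r.occurs m := by
  induction n, hmn using Nat.le_induction with
  | base => exact hn
  | succ n _ ih => exact ih ((hr.occurs_succ n).1 hn).1

theorem time_le_time (hr : r.IsExecution G h) {m n : ℕ} (hmn : m ≤ n) (hn : r.occurs n) :
    r.time m ≤ r.time n := by
  induction n, hmn using Nat.le_induction with
  | base => exact le_rfl
  | succ n _ ih =>
    exact (ih ((hr.occurs_succ n).1 hn).1).trans (hr.time_succ n hn).1.1

/-- After an update, every banned goal is held by an agent that has kept it and is not banned
from it. -/
theorem exists_holder (hr : r.IsExecution G h) {n : ℕ} (hn : r.occurs (n + 1))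
    (hgoal : ∀ i, ∃ k, r.goal n i = some k ∧ k ∉ r.ban n i)
    (hban : ∀ j, ∀ k ∈ r.ban n j, ∃ i, r.goal n i = some k)
    {j : Fin N} {k : Fin M} (hk : k ∈ r.ban (n + 1) j) :
    ∃ i, r.goal n i = some k ∧ k ∉ r.ban (n + 1) i ∧ r.goal (n + 1) i = some k := by
  obtain ⟨i₀, hi₀⟩ : ∃ i, r.goal n i = some k := by
    by_cases hl : r.LosesAt h n j
    · rw [hr.loser_ban n j hn hl, Finset.mem_union, Option.mem_toFinset] at hk
      exact hk.elim (hban j k) fun hg => ⟨j, hg⟩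
    · rw [hr.keep_ban n j hn hl] at hk
      exact hban j k hk
  obtain ⟨i, hi, hnl⟩ := exists_not_loses (hr.priority n hn) h
    (fun j => r.state j (r.time (n + 1))) (r.goal n) hi₀
  refine ⟨i, hi, ?_, by rw [hr.keep_goal n i hn hnl, hi]⟩
  obtain ⟨l, hl, hlb⟩ := hgoal i
  rw [hr.keep_ban n i hn hnl, Option.some_injective _ (hi.symm.trans hl)]
  exact hlb

/-- At all times every agent has a goal that it is not banned from, and all banned goals are
held by some agent. -/
theorem goal_and_ban (hr : r.IsExecution G h) (hNM : N ≤ M) (hh : 0 < h) {n : ℕ}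
    (hn : r.occurs n) :
    (∀ i, ∃ k, r.goal n i = some k ∧ k ∉ r.ban n i) ∧
      ∀ j, ∀ k ∈ r.ban n j, ∃ i, r.goal n i = some k := by
  induction n with
  | zero =>
    refine ⟨fun i => (hr.goal_zero i).exists_eq_some hh
      ⟨Fin.castLE hNM, Fin.castLE_injective hNM, fun j => by simp [hr.ban_zero]⟩, ?_⟩
    simp [hr.ban_zero]
  | succ n ih =>
    obtain ⟨hgoal, hban⟩ := ih ((hr.occurs_succ n).1 hn).1
    -- Hall's condition uses the new bans with the old goals, since the losers' new goals are not
    -- yet known to exist; the winners' new goals carry the second invariant on.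
    have hold := fun j k => hr.exists_holder hn hgoal hban (j := j) (k := k)
    refine ⟨fun i => ?_, fun j k hk => (hold j k hk).imp fun i hi => hi.2.2⟩
    by_cases hl : r.LosesAt h n i
    · exact (hr.loser_goal n i hn hl).exists_eq_some hh
        (exists_injective_notMem_ban hNM _ (r.goal n) fun j k hk =>
          (hold j k hk).imp fun i hi => ⟨hi.1, hi.2.1⟩)
    · rw [hr.keep_goal n i hn hl, hr.keep_ban n i hn hl]
      exact hgoal i

theorem ban_subset_succ (hr : r.IsExecution G h) {n : ℕ} (hn : r.occurs (n + 1)) (i : Fin N) :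
    r.ban n i ⊆ r.ban (n + 1) i := by
  by_cases hl : r.LosesAt h n i
  · rw [hr.loser_ban n i hn hl]
    exact Finset.subset_union_left
  · rw [hr.keep_ban n i hn hl]

/-- Every update bans some agent from a further goal. -/
theorem le_sum_card_ban (hr : r.IsExecution G h) (hNM : N ≤ M) (hh : 0 < h) {n : ℕ}
    (hn : r.occurs n) : n ≤ ∑ i, (r.ban n i).card := by
  induction n with
  | zero => exact Nat.zero_le _
  | succ n ih =>
    have hn' := ((hr.occurs_succ n).1 hn).1
    obtain ⟨i, hi⟩ := (hr.time_succ n hn).1.2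
    obtain ⟨j, hj⟩ := exists_loses (hr.priority n hn) hi
    -- The loser's goal was not banned before, so its ban set grows strictly.
    obtain ⟨k, hk, hkb⟩ := (hr.goal_and_ban hNM hh hn').1 j
    have hlt : ∑ i, (r.ban n i).card < ∑ i, (r.ban (n + 1) i).card := by
      refine Finset.sum_lt_sum (fun i _ => Finset.card_le_card (hr.ban_subset_succ hn i))
        ⟨j, Finset.mem_univ j, Finset.card_lt_card ?_⟩
      refine (Finset.ssubset_iff_of_subset (hr.ban_subset_succ hn j)).2 ⟨k, ?_, hkb⟩
      rw [hr.loser_ban n j hn hj]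
      simp [hk]
    have := ih hn'
    omega

/-- Only finitely many updates take place. -/
theorem exists_last_update (hr : r.IsExecution G h) (hNM : N ≤ M) (hh : 0 < h) :
    ∃ n, r.occurs n ∧ ¬ r.occurs (n + 1) := by
  by_contra! H
  have hall : ∀ n, r.occurs n := fun n => by
    induction n with
    | zero => exact hr.occurs_zero
    | succ n ih => exact H n ih
  have h1 := hr.le_sum_card_ban hNM hh (hall (N * M + 1))
  have h2 : ∑ i, (r.ban (N * M + 1) i).card ≤ ∑ _i : Fin N, M :=
    Finset.sum_le_sum fun i _ => by simpa using Finset.card_le_univ (r.ban (N * M + 1) i)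
  simp at h2
  omega

/-- Every agent has a last assignment up to update `n`, and has kept its goal since then. -/
theorem exists_last_assigned (hr : r.IsExecution G h) (i : Fin N) {n : ℕ} (hn : r.occurs n) :
    ∃ m ≤ n, r.occurs m ∧ i ∈ r.assigned m ∧ r.goal m i = r.goal n i ∧
      ∀ l, m < l → l ≤ n → i ∉ r.assigned l := by
  induction n with
  | zero =>
    exact ⟨0, le_rfl, hn, by simp [hr.assigned_zero], rfl, fun l h1 h2 => by omega⟩
  | succ n ih =>
    by_cases hi : i ∈ r.assigned (n + 1)
    · exact ⟨n + 1, le_rfl, hn, hi, rfl, fun l h1 h2 => by omega⟩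
    · obtain ⟨m, hmn, hm, him, hg, hl⟩ := ih ((hr.occurs_succ n).1 hn).1
      refine ⟨m, hmn.trans n.le_succ, hm, him, ?_, fun l h1 h2 => ?_⟩
      · rw [hg, hr.keep_goal n i hn fun hlose => hi (hr.loser_assigned n i hn hlose)]
      · rcases Nat.le_succ_iff.1 h2 with h3 | rfl
        · exact hl l h1 h3
        · exact hi

/-- After the last update every agent joins its goal in finite time and stays with it. -/
theorem exists_arrival (hr : r.IsExecution G h) {n : ℕ} (hn : r.occurs n)
    (hlast : ¬ r.occurs (n + 1)) {i : Fin N} {k : Fin M} (hk : r.goal n i = some k) :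
    ∃ Tf, ∀ t, Tf ≤ t → r.state i t = G.state k t := by
  obtain ⟨m, hmn, hm, him, hg, hl⟩ := hr.exists_last_assigned i hn
  obtain ⟨T, hT, _, hstay⟩ := hr.motion m i k ⟨hm, him, hg.trans hk⟩
    (exists_isOptimalArrival G k _ _)
  have hT0 : 0 ≤ T := hT.1.elim le_of_lt fun h => h.1.ge
  -- The plan made at update `m` stays in force forever: up to `n` the agent is not assigned again,
  -- and beyond `n` no update occurs.
  refine ⟨r.time m + T, fun t ht => hstay t ⟨by linarith, fun l hml hol hil => ?_⟩ ht⟩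
  refine absurd hil (hl l hml ?_)
  by_contra! H
  exact hlast (hr.occurs_of_le H hol)

end Run.IsExecution

end GoalAssignment

theorem theorem1 {N M : ℕ} (hNM : N ≤ M) (G : GoalAssignment.PolyGoals M) (h : ℝ) (hh : 0 < h)
    (r : GoalAssignment.Run N M) (hr : r.IsExecution G h) (hE : r.EnergyNonincreasing G) :
    ∃ (g : Fin N → Fin M) (n : ℕ) (Tf : ℝ),
      Function.Injective g ∧
      r.occurs n ∧ ¬ r.occurs (n + 1) ∧ (∀ i, r.goal n i = some (g i)) ∧
      r.time n ≤ Tf ∧ ∀ i, ∀ t, Tf ≤ t → r.state i t = G.state (g i) t := by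
  obtain ⟨n, hn, hlast⟩ := hr.exists_last_update hNM hh
  choose g hg _ using (hr.goal_and_ban hNM hh hn).1
  choose A hA using fun i => hr.exists_arrival hn hlast (hg i)
  obtain ⟨C, hC⟩ := (Set.finite_range A).bddAbove
  have hAC : ∀ i, A i ≤ max (r.time n) C := fun i => (hC ⟨i, rfl⟩).trans (le_max_right _ _)
  refine ⟨g, n, max (r.time n) C, fun i j hij => ?_, hn, hlast, hg, le_max_left _ _,
    fun i t ht => hA i t ((hAC i).trans ht)⟩
  by_contra hne
  -- At this time both agents sit on the same goal, at distance `0 ≤ h`, which is a conflict after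
  -- the last update.
  refine hlast ((hr.occurs_succ n).2 ⟨hn, max (r.time n) C, le_max_left _ _, i, j, ?_⟩)
  refine GoalAssignment.mem_competing.2 ⟨?_, Ne.symm hne, g i, hg i, hij ▸ hg j⟩
  simp only [hA i _ (hAC i), hA j _ (hAC j), hij, dist_self]
  exact hh.le
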